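/- Let $d\ge 1$ and $\tau\ge 0$ be integers, and let $\mathcal X\subset\mathbb R^d$ be a non-empty set with $\|x\|\le u_x$ for all $x\in\mathcal X$, where $u_x\ge 1$. Let $\psi:\mathbb R\to\mathbb R$ be three times continuously differentiable with $\psi''>0$ everywhere, let $\theta^*\in\mathbb R^d$ and $\sigma>0$, and put $$\kappa=\inf_{x\in\mathcal X,\ \|\theta-\theta^*\|\le 1}\psi''(x^\top\theta)\wedge 1,\qquad M_{\psi3}=\sup_{x\in\mathcal X,\ \|\theta-\theta^*\|\le 1}|\psi'''(x^\top\theta)|\vee 1 .$$ Let $x_1,\dots,x_\tau$ be random covariates with values in $\mathcal X$ and let $y_1,\dots,y_\tau$ be real responses that are conditionally independent given $(x_1,\dots,x_\tau)$, such that, conditionally on the covariates, $y_t$ has mean $\psi'(x_t^\top\theta^*)$ and $\varepsilon_t=y_t-\psi'(x_t^\top\theta^*)$ is sub-Gaussian with variance proxy $\sigma^2$, that is, $\mathbb E[e^{s\varepsilon_t}\mid x_1,\dots,x_\tau]\le e^{s^2\sigma^2/2}$ for all $s\in\mathbb R$ (as for a generalized linear model with canonical link and sub-Gaussian errors). Let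 $V_\tau=\sum_{t=1}^\tau x_tx_t^\top$, let $\lambda_{\min}(V_\tau)$ be its smallest eigenvalue, let $\|x\|_{V_\tau^{-1}}=\sqrt{x^\top V_\tau^{-1}x}$, and let the MLE $\widehat\theta$ be the maximizer over $\mathbb R^d$ of $L(\theta)=\sum_{t=1}^\tau\{y_tx_t^\top\theta-\psi(x_t^\top\theta)\}$. Let $\delta\in(0,1)$. All probabilities below are conditional on $(x_1,\dots,x_\tau)$, and the statements hold for almost every value of the covariates that satisfies the stated eigenvalue condition. **(A)** Let $\varsigma\in(0,1]$. If $$\lambda_{\min}(V_\tau)\ \ge\ \frac{3\sigma^2}{\kappa^2\varsigma^2}\{d+\log(1/\delta)\},$$ then with probability at least $1-\delta$ the MLE $\widehat\theta$ exists, is unique, and satisfies simultaneously (i) $\|\widehat\theta-\theta^*\|\le\varsigma$; (ii) $(\widehat\theta-\theta^*)^\top V_\tau(\widehat\theta-\theta^*)\le \dfrac{12\sigma^2}{\kappa^2}\{d+\log(1/\delta)\}$; (iii) $\|\widehat\theta-\theta^*\|\le \dfrac{\sqrt3\,\sigma}{\kappa\sqrt{\lambda_{\min}(V_\tau)}}\sqrt{d+\log(1/\delta)}$.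 **(B)** If $$\lambda_{\min}(V_\tau)\ \ge\ \frac{512\,u_x^2M_{\psi3}^2\sigma^2}{\kappa^4}\{d^2+\log(1/\delta)\},$$ then for every $x\in\mathbb R^d$, with probability at least $1-3\delta$ the MLE $\widehat\theta$ exists, is unique, and satisfies $\|\widehat\theta-\theta^*\|\le1$ and $$|x^\top(\widehat\theta-\theta^*)|\le\frac{3\sigma}{\kappa}\sqrt{\log(1/\delta)}\ \|x\|_{V_\tau^{-1}} .$$ -/

import Mathlib

open MeasureTheory ProbabilityTheory
open scoped NNReal ENNReal RealInnerProductSpace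

namespace GLM

/-- The design matrix `V = ∑ₜ xₜ xₜᵀ`. -/
def designMatrix {d τ : ℕ} (x : Fin τ → EuclideanSpace ℝ (Fin d)) :
    Matrix (Fin d) (Fin d) ℝ :=
  ∑ t, Matrix.vecMulVec (fun i => x t i) (fun i => x t i)

theorem designMatrix_isHermitian {d τ : ℕ} (x : Fin τ → EuclideanSpace ℝ (Fin d)) :
    (designMatrix x).IsHermitian := by
  unfold designMatrix Matrix.IsHermitian
  rw [Matrix.conjTranspose_sum]
  refine Finset.sum_congr rfl fun t _ => ?_
  ext i j
  simp [Matrix.vecMulVec_apply, mul_comm]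

/-- The smallest eigenvalue of the design matrix. -/
noncomputable def minEigenvalue {d τ : ℕ} (x : Fin τ → EuclideanSpace ℝ (Fin d)) : ℝ :=
  ⨅ i : Fin d, (designMatrix_isHermitian x).eigenvalues i

/-- The quadratic form `vᵀ A v`. -/
def quadForm {d : ℕ} (A : Matrix (Fin d) (Fin d) ℝ) (v : EuclideanSpace ℝ (Fin d)) : ℝ :=
  dotProduct (fun i => v i) (A.mulVec (fun i => v i))

/-- The GLM log-likelihood `L(θ) = ∑ₜ (yₜ xₜᵀθ - ψ(xₜᵀθ))`. -/
noncomputable def logLik {d τ : ℕ} (ψ : ℝ → ℝ) (x : Fin τ → EuclideanSpace ℝ (Fin d))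
    (y : Fin τ → ℝ) (θ : EuclideanSpace ℝ (Fin d)) : ℝ :=
  ∑ t, (y t * ⟪x t, θ⟫ - ψ ⟪x t, θ⟫)

/-- `θ'` is a maximum likelihood estimate: a global maximizer of the log-likelihood. -/
def IsMLE {d τ : ℕ} (ψ : ℝ → ℝ) (x : Fin τ → EuclideanSpace ℝ (Fin d))
    (y : Fin τ → ℝ) (θ' : EuclideanSpace ℝ (Fin d)) : Prop :=
  ∀ θ, logLik ψ x y θ ≤ logLik ψ x y θ'

/-- `κ = inf { ψ''(xᵀθ) : x ∈ 𝒳, ‖θ - θ*‖ ≤ 1 } ∧ 1`. -/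
noncomputable def kappa {d : ℕ} (ψ : ℝ → ℝ) (𝒳 : Set (EuclideanSpace ℝ (Fin d)))
    (θs : EuclideanSpace ℝ (Fin d)) : ℝ :=
  min (sInf {a : ℝ | ∃ x ∈ 𝒳, ∃ θ, ‖θ - θs‖ ≤ 1 ∧ a = iteratedDeriv 2 ψ ⟪x, θ⟫}) 1

/-- `M = sup { |ψ'''(xᵀθ)| : x ∈ 𝒳, ‖θ - θ*‖ ≤ 1 } ∨ 1`. -/
noncomputable def thirdDerivBound {d : ℕ} (ψ : ℝ → ℝ) (𝒳 : Set (EuclideanSpace ℝ (Fin d)))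
    (θs : EuclideanSpace ℝ (Fin d)) : ℝ :=
  max (sSup {a : ℝ | ∃ x ∈ 𝒳, ∃ θ, ‖θ - θs‖ ≤ 1 ∧ a = |iteratedDeriv 3 ψ ⟪x, θ⟫|}) 1

/-- The sampling model: covariates in `𝒳`; given the covariates, the responses are independent,
`yₜ` has mean `ψ'(xₜᵀθ*)`, and the error `yₜ - ψ'(xₜᵀθ*)` is sub-Gaussian with variance proxy
`σ²`. Here `condDistrib Y X μ x` is the conditional law of `Y = (y₁, …, y_τ)` given
`X = (x₁, …, x_τ)` at the value `x`. -/
structure CondIndepModel {Ω : Type*} [MeasurableSpace Ω] {d τ : ℕ}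
    (μ : Measure Ω) [IsProbabilityMeasure μ]
    (X : Ω → Fin τ → EuclideanSpace ℝ (Fin d)) (Y : Ω → Fin τ → ℝ)
    (𝒳 : Set (EuclideanSpace ℝ (Fin d))) (ψ : ℝ → ℝ)
    (θs : EuclideanSpace ℝ (Fin d)) (σ : ℝ≥0) : Prop where
  measurable_covariates : Measurable X
  measurable_responses : Measurable Y
  covariates_mem : ∀ᵐ ω ∂μ, ∀ t, X ω t ∈ 𝒳
  condIndep : ∀ᵐ x ∂(μ.map X),
    iIndepFun (fun (t : Fin τ) (y : Fin τ → ℝ) => y t) (condDistrib Y X μ x)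
  condMean : ∀ᵐ x ∂(μ.map X), ∀ t,
    ∫ y, y t ∂(condDistrib Y X μ x) = deriv ψ ⟪x t, θs⟫
  subGaussian : ∀ᵐ x ∂(μ.map X), ∀ t,
    HasSubgaussianMGF (fun y : Fin τ → ℝ => y t - deriv ψ ⟪x t, θs⟫) (σ ^ 2)
      (condDistrib Y X μ x)

end GLM

namespace GLM

/-! Write `A` for `designMap x`, so that `‖A v‖² = vᵀ V v`, `ε` for the error vector, `λ` for the
smallest eigenvalue and `ℓ = log (1 / δ)`. Given the covariates, each `⟨ε, u⟩` is sub-Gaussian with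
proxy `σ² ‖u‖²`. The projection of `ε` onto the range of `A` has dimension at most `d`; averaging
its moment generating function over a Gaussian direction bounds the exponential moment of its
squared norm (`lintegral_exp_sum_sq_le`). So off an event of probability `δ`, `⟨ε, A v⟩ ≤ R ‖A v‖`
for all `v`, with `R = σ √(3 (d + ℓ))`.

Part (A) is then deterministic (`existsUnique_isMLE`). On the sphere of radius `ς` about `θs` the
curvature `κ ‖A v‖²` dominates the noise `R ‖A v‖`, because `‖A v‖ ≥ √λ ς`. Concavity traps the
maximizer in the ball, and the score equation gives `κ ‖A (θ - θs)‖ ≤ R`.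

For (B), solve `v = H w` with `H` the negative Hessian at `θs` (`exists_weighted_representer`).
Testing the linearised score equation against `w` gives `⟨v, θ - θs⟩ = ⟨ε, A w⟩` up to a quadratic
remainder (`IsMLE.abs_inner_le`). Given the covariates `w` is fixed, so the main term has a
dimension-free tail; part (A) and the size of `λ` absorb the remainder. -/

/-! ### Exponential moments of squared norms -/

theorem integral_exp_sq_div_three_gaussianReal :
    ∫ g, Real.exp (g ^ 2 / 3) ∂(gaussianReal 0 1) = √3 := by
  rw [integral_gaussianReal_eq_integral_smul one_ne_zero]
  have h : ∀ g : ℝ, gaussianPDFReal 0 1 g • Real.exp (g ^ 2 / 3)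
      = (√(2 * Real.pi))⁻¹ * Real.exp (-(1 / 6) * g ^ 2) := by
    intro g
    rw [gaussianPDFReal, smul_eq_mul, mul_assoc, ← Real.exp_add]
    congr 2
    · simp
    · simp; ring
  simp_rw [h]
  rw [integral_const_mul, integral_gaussian, inv_mul_eq_div, ← Real.sqrt_div (by positivity)]
  congr 1
  field_simp
  norm_num

theorem lintegral_pi_ofReal_prod {ι : Type*} [Fintype ι] {ν : Measure ℝ} [SigmaFinite ν]
    (f : ι → ℝ → ℝ) (hf : ∀ i, Integrable (f i) ν) (hf0 : ∀ i g, 0 ≤ f i g) :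
    ∫⁻ g : ι → ℝ, ENNReal.ofReal (∏ i, f i (g i)) ∂(Measure.pi fun _ => ν)
      = ENNReal.ofReal (∏ i, ∫ g, f i g ∂ν) := by
  rw [← ofReal_integral_eq_lintegral_ofReal (Integrable.fintype_prod hf)
    (ae_of_all _ fun g => Finset.prod_nonneg fun i _ => hf0 i _), integral_fintype_prod_eq_prod]

/-- If every linear combination `∑ bᵢ Wᵢ` has moment generating function at most that of a centered
Gaussian with variance `∑ bᵢ²`, the exponential moment of `∑ Wᵢ²` at `1 / 3` is at most the one of a
chi-square variable. -/
theorem lintegral_exp_sum_sq_le {Ω ι : Type*} [Fintype ι] [MeasurableSpace Ω] {P : Measure Ω}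
    [SFinite P] {W : ι → Ω → ℝ} (hW : ∀ i, Measurable (W i))
    (h : ∀ b : ι → ℝ, ∫⁻ ω, ENNReal.ofReal (Real.exp (∑ i, b i * W i ω)) ∂P
      ≤ ENNReal.ofReal (Real.exp ((∑ i, b i ^ 2) / 2))) :
    ∫⁻ ω, ENNReal.ofReal (Real.exp ((∑ i, W i ω ^ 2) / 3)) ∂P
      ≤ ENNReal.ofReal (√3 ^ Fintype.card ι) := by
  -- Chosen so that a standard Gaussian `g` has `E exp (c g w) = exp (c² w² / 2) = exp (w² / 3)`.
  set c : ℝ := √(2 / 3) with hc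
  have hc2 : c ^ 2 = 2 / 3 := Real.sq_sqrt (by norm_num)
  let G : Measure (ι → ℝ) := Measure.pi fun _ => gaussianReal 0 1
  have h1 : ∀ w : ι → ℝ, ∫⁻ g, ENNReal.ofReal (Real.exp (∑ i, c * g i * w i)) ∂G
      = ENNReal.ofReal (Real.exp ((∑ i, w i ^ 2) / 3)) := by
    intro w
    have e1 : ∀ g : ι → ℝ, Real.exp (∑ i, c * g i * w i) = ∏ i, Real.exp ((c * w i) * g i) := by
      intro g
      rw [Real.exp_sum]
      exact Finset.prod_congr rfl fun i _ => by congr 1; ring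
    simp_rw [e1]
    rw [lintegral_pi_ofReal_prod (fun i g => Real.exp ((c * w i) * g))
      (fun i => integrable_exp_mul_gaussianReal _) (fun i g => (Real.exp_pos _).le)]
    have e2 : ∀ t : ℝ, ∫ g, Real.exp (t * g) ∂(gaussianReal 0 1) = Real.exp (t ^ 2 / 2) := by
      intro t
      have := congrFun (mgf_fun_id_gaussianReal (μ := 0) (v := 1)) t
      simpa [mgf] using this
    simp_rw [e2]
    rw [← Real.exp_sum, Finset.sum_div]
    congr 2
    exact Finset.sum_congr rfl fun i _ => by rw [mul_pow, hc2]; ring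
  have h2 : ∫⁻ g, ENNReal.ofReal (Real.exp ((∑ i, (c * g i) ^ 2) / 2)) ∂G
      = ENNReal.ofReal (√3 ^ Fintype.card ι) := by
    have e1 : ∀ g : ι → ℝ, Real.exp ((∑ i, (c * g i) ^ 2) / 2) = ∏ i, Real.exp (g i ^ 2 / 3) := by
      intro g
      rw [← Real.exp_sum, Finset.sum_div]
      congr 1
      exact Finset.sum_congr rfl fun i _ => by rw [mul_pow, hc2]; ring
    simp_rw [e1]
    rw [lintegral_pi_ofReal_prod (fun _ g => Real.exp (g ^ 2 / 3))]
    · simp [integral_exp_sq_div_three_gaussianReal]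
    · intro _
      -- A non-integrable function would have Bochner integral `0`.
      refine Integrable.of_integral_ne_zero ?_
      rw [integral_exp_sq_div_three_gaussianReal]
      positivity
    · intro _ g
      positivity
  rw [← h2]
  simp_rw [← h1]
  -- Tonelli; for each fixed `g` the hypothesis applies with `b = c g`.
  rw [lintegral_lintegral_swap]
  · exact lintegral_mono fun g => h fun i => c * g i
  · refine Measurable.aemeasurable ?_
    simp only [Function.uncurry_def]
    fun_prop

/-- Tail bound for the squared norm of a sub-Gaussian random vector. -/
theorem measure_sum_sq_gt_le {Ω ι : Type*} [Fintype ι] [MeasurableSpace Ω] {P : Measure Ω}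
    [SFinite P] {W : ι → Ω → ℝ} (hW : ∀ i, Measurable (W i))
    (h : ∀ b : ι → ℝ, ∫⁻ ω, ENNReal.ofReal (Real.exp (∑ i, b i * W i ω)) ∂P
      ≤ ENNReal.ofReal (Real.exp ((∑ i, b i ^ 2) / 2)))
    {d : ℕ} (hd : Fintype.card ι ≤ d) {δ : ℝ} (hδ : 0 < δ) :
    P {ω | 3 * (d + Real.log (1 / δ)) < ∑ i, W i ω ^ 2} ≤ ENNReal.ofReal δ := by
  set L := Real.log (1 / δ) with hL
  have hexp : Real.exp (d + L) = Real.exp 1 ^ d * (1 / δ) := by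
    rw [Real.exp_add, hL, Real.exp_log (by positivity), ← Real.exp_nat_mul, mul_one]
  have hmono : P {ω | 3 * (d + L) < ∑ i, W i ω ^ 2}
      ≤ P {ω | ENNReal.ofReal (Real.exp (d + L))
          ≤ ENNReal.ofReal (Real.exp ((∑ i, W i ω ^ 2) / 3))} := by
    refine measure_mono fun ω hω => ?_
    simp only [Set.mem_ofPred_eq] at hω ⊢
    exact ENNReal.ofReal_le_ofReal (Real.exp_le_exp.2 (by linarith))
  have hne : ENNReal.ofReal (Real.exp (d + L)) ≠ 0 := by
    simpa using Real.exp_pos _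
  refine hmono.trans ((meas_ge_le_lintegral_div ?_ hne ENNReal.ofReal_ne_top).trans ?_)
  · exact Measurable.aemeasurable (by fun_prop)
  refine (ENNReal.div_le_div_right (lintegral_exp_sum_sq_le hW h) _).trans ?_
  rw [← ENNReal.ofReal_div_of_pos (Real.exp_pos _)]
  refine ENNReal.ofReal_le_ofReal ?_
  rw [div_le_iff₀ (Real.exp_pos _), hexp]
  -- This turns the chi-square moment `√3 ^ card ι` into `exp d`, hence the summand `d` in the
  -- threshold.
  have h3 : √3 ≤ Real.exp 1 := by
    have h2 := Real.exp_one_gt_d9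
    have : √3 ≤ 2 := by rw [Real.sqrt_le_left (by norm_num)]; norm_num
    linarith
  have h1 : (1 : ℝ) ≤ Real.exp 1 := Real.one_le_exp (by norm_num)
  calc √3 ^ Fintype.card ι ≤ Real.exp 1 ^ Fintype.card ι := by gcongr
    _ ≤ Real.exp 1 ^ d := pow_le_pow_right₀ h1 hd
    _ = δ * (Real.exp 1 ^ d * (1 / δ)) := by field_simp

/-! ### Concentration of independent sub-Gaussian errors -/

section Noise

variable {Ω : Type*} [MeasurableSpace Ω] {P : Measure Ω} {τ : ℕ} {ε : Fin τ → Ω → ℝ} {σ : ℝ≥0}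

theorem hasSubgaussianMGF_linearCombination (hind : iIndepFun ε P)
    (hsub : ∀ t, HasSubgaussianMGF (ε t) (σ ^ 2) P) (a : EuclideanSpace ℝ (Fin τ)) :
    HasSubgaussianMGF (fun ω => ∑ t, a t * ε t ω) (‖a‖₊ ^ 2 * σ ^ 2) P := by
  have hind' : iIndepFun (fun t ω => a t * ε t ω) P :=
    hind.comp (fun t z => a t * z) fun t => measurable_const_mul _
  have := HasSubgaussianMGF.sum_of_iIndepFun hind' (s := Finset.univ)
    (c := fun t => NNReal.mk (a t ^ 2) (sq_nonneg _) * σ ^ 2)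
    (fun t _ => (hsub t).const_mul (a t))
  convert this using 1
  rw [← Finset.sum_mul]
  congr 1
  ext
  simp [EuclideanSpace.real_norm_sq_eq]

/-- Two-sided tail bound for a linear combination of the errors. -/
theorem measure_linearCombination_abs_gt_le [IsProbabilityMeasure P] (hind : iIndepFun ε P)
    (hsub : ∀ t, HasSubgaussianMGF (ε t) (σ ^ 2) P) (hσ : 0 < σ)
    (a : EuclideanSpace ℝ (Fin τ)) {δ : ℝ} (hδ0 : 0 < δ) (hδ1 : δ < 1) :
    P {ω | √2 * σ * √(Real.log (1 / δ)) * ‖a‖ < |∑ t, a t * ε t ω|} ≤ ENNReal.ofReal (2 * δ) := by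
  have hL : 0 < Real.log (1 / δ) := Real.log_pos ((one_lt_div hδ0).2 hδ1)
  rcases eq_or_ne a 0 with rfl | ha
  · simp
  have ha' : 0 < ‖a‖ := norm_pos_iff.2 ha
  have hσ' : (0 : ℝ) < σ := hσ
  set r := √2 * σ * √(Real.log (1 / δ)) * ‖a‖ with hr
  have key : ∀ Z : Ω → ℝ, HasSubgaussianMGF Z (‖a‖₊ ^ 2 * σ ^ 2) P →
      P {ω | r ≤ Z ω} ≤ ENNReal.ofReal δ := by
    intro Z hZ
    have := hZ.measure_ge_le (ε := r) (by positivity)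
    -- `r` is calibrated to make the Chernoff bound exactly `δ`.
    have hexp : -r ^ 2 / (2 * ((‖a‖₊ ^ 2 * σ ^ 2 : ℝ≥0) : ℝ)) = Real.log δ := by
      rw [hr, mul_pow, mul_pow, mul_pow, Real.sq_sqrt hL.le, Real.sq_sqrt (by norm_num)]
      push_cast
      rw [one_div, Real.log_inv]
      field_simp
    rw [hexp, Real.exp_log hδ0] at this
    rw [← ofReal_measureReal]
    exact ENNReal.ofReal_le_ofReal this
  have hsum := hasSubgaussianMGF_linearCombination hind hsub a
  have h2 : ENNReal.ofReal (2 * δ) = ENNReal.ofReal δ + ENNReal.ofReal δ := by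
    rw [← ENNReal.ofReal_add hδ0.le hδ0.le]; ring_nf
  rw [h2]
  refine le_trans (measure_mono ?_) ((measure_union_le _ _).trans
    (add_le_add (key _ hsum) (key _ hsum.neg)))
  intro ω hω
  rcases lt_abs.1 (show r < |∑ t, a t * ε t ω| from hω) with h | h
  · exact Or.inl h.le
  · exact Or.inr h.le

/-- Uniformly over a subspace of dimension at most `d`, the errors are correlated with no vector by
more than `σ √(3 (d + log (1 / δ)))` times its norm, up to probability `δ`. -/
theorem measure_exists_mem_submodule_gt_le [IsProbabilityMeasure P] (hind : iIndepFun ε P)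
    (hmeas : ∀ t, Measurable (ε t))
    (hsub : ∀ t, HasSubgaussianMGF (ε t) (σ ^ 2) P) (hσ : 0 < σ)
    (S : Submodule ℝ (EuclideanSpace ℝ (Fin τ))) {d : ℕ} (hS : Module.finrank ℝ S ≤ d)
    {δ : ℝ} (hδ0 : 0 < δ) :
    P {ω | ∃ u ∈ S, σ * √(3 * (d + Real.log (1 / δ))) * ‖u‖ < ∑ t, u t * ε t ω}
      ≤ ENNReal.ofReal δ := by
  have hσ' : (0 : ℝ) < σ := hσ
  let e := stdOrthonormalBasis ℝ S
  -- Coordinates of the projection of `ε / σ` onto `S`.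
  let W : Fin (Module.finrank ℝ S) → Ω → ℝ :=
    fun i ω => ∑ t, ((σ : ℝ)⁻¹ • (e i : EuclideanSpace ℝ (Fin τ))) t * ε t ω
  have hlin : ∀ (b : Fin (Module.finrank ℝ S) → ℝ) (ω : Ω), ∑ i, b i * W i ω
      = ∑ t, ((σ : ℝ)⁻¹ • ((∑ i, b i • e i : S) : EuclideanSpace ℝ (Fin τ))) t * ε t ω := by
    intro b ω
    simp only [W, Finset.mul_sum, Submodule.coe_sum, Submodule.coe_smul, PiLp.smul_apply,
      WithLp.ofLp_sum, WithLp.ofLp_smul, Finset.sum_apply, Pi.smul_apply, smul_eq_mul,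
      Finset.sum_mul]
    rw [Finset.sum_comm]
    exact Finset.sum_congr rfl fun t _ => Finset.sum_congr rfl fun i _ => by ring
  have hnorm : ∀ b : Fin (Module.finrank ℝ S) → ℝ, ‖(∑ i, b i • e i : S)‖ ^ 2 = ∑ i, b i ^ 2 := by
    intro b
    rw [← real_inner_self_eq_norm_sq, e.orthonormal.inner_sum]
    simp [sq]
  have hWm : ∀ i, Measurable (W i) := fun i => by fun_prop
  have hW : ∀ b : Fin (Module.finrank ℝ S) → ℝ,
      ∫⁻ ω, ENNReal.ofReal (Real.exp (∑ i, b i * W i ω)) ∂P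
      ≤ ENNReal.ofReal (Real.exp ((∑ i, b i ^ 2) / 2)) := by
    intro b
    have h := hasSubgaussianMGF_linearCombination hind hsub
      ((σ : ℝ)⁻¹ • ((∑ i, b i • e i : S) : EuclideanSpace ℝ (Fin τ)))
    have hint := h.integrable_exp_mul 1
    have hle := h.mgf_le 1
    simp only [mgf, one_mul, ← hlin] at hint hle
    rw [← ofReal_integral_eq_lintegral_ofReal hint (ae_of_all _ fun ω => (Real.exp_pos _).le)]
    refine ENNReal.ofReal_le_ofReal (hle.trans_eq ?_)
    congr 1
    rw [NNReal.coe_mul, NNReal.coe_pow, NNReal.coe_pow, coe_nnnorm, norm_smul, mul_pow, norm_inv, Real.norm_of_nonneg hσ'.le, ← Submodule.coe_norm,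
      hnorm]
    field_simp
  refine le_trans (measure_mono ?_) (measure_sum_sq_gt_le hWm hW (by simpa using hS) hδ0)
  rintro ω ⟨u, hu, hlt⟩
  simp only [Set.mem_ofPred_eq]
  by_contra! hle
  refine absurd hlt (not_lt.2 ?_)
  let b : Fin (Module.finrank ℝ S) → ℝ := fun i => e.repr ⟨u, hu⟩ i
  have hb : (∑ i, b i • e i : S) = ⟨u, hu⟩ := e.sum_repr _
  have hub : ‖u‖ ^ 2 = ∑ i, b i ^ 2 := by rw [← hnorm, hb]; rfl
  have hsum : ∑ t, u t * ε t ω = σ * ∑ i, b i * W i ω := by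
    rw [hlin, hb, Finset.mul_sum]
    refine Finset.sum_congr rfl fun t _ => ?_
    simp only [PiLp.smul_apply, smul_eq_mul]
    field_simp
  rw [hsum, mul_assoc]
  refine mul_le_mul_of_nonneg_left ?_ hσ'.le
  refine le_trans (Real.sum_mul_le_sqrt_mul_sqrt _ _ _) ?_
  rw [← hub, Real.sqrt_sq (norm_nonneg _), mul_comm]
  gcongr

end Noise

/-! ### Geometry of the design matrix -/

section Design

variable {d τ : ℕ} (x : Fin τ → EuclideanSpace ℝ (Fin d))

/-- The linear predictor `θ ↦ (xₜᵀθ)ₜ`. -/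
noncomputable def designMap : EuclideanSpace ℝ (Fin d) →ₗ[ℝ] EuclideanSpace ℝ (Fin τ) where
  toFun θ := WithLp.toLp 2 fun t => ⟪x t, θ⟫
  map_add' θ θ' := by ext t; simp [inner_add_right]
  map_smul' c θ := by ext t; simp [inner_smul_right]

@[simp]
theorem designMap_apply (θ : EuclideanSpace ℝ (Fin d)) (t : Fin τ) :
    designMap x θ t = ⟪x t, θ⟫ := rfl

theorem designMatrix_mulVec (v : EuclideanSpace ℝ (Fin d)) :
    (designMatrix x).mulVec (fun i => v i) = fun i => ∑ t, ⟪x t, v⟫ * x t i := by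
  ext i
  simp only [designMatrix, Matrix.sum_mulVec, Matrix.vecMulVec_mulVec, Finset.sum_apply]
  refine Finset.sum_congr rfl fun t _ => ?_
  simp [dotProduct, PiLp.inner_apply, mul_comm]

theorem dotProduct_designMatrix_mulVec (u v : EuclideanSpace ℝ (Fin d)) :
    dotProduct (fun i => u i) ((designMatrix x).mulVec (fun i => v i))
      = ⟪designMap x u, designMap x v⟫ := by
  rw [designMatrix_mulVec]
  simp only [dotProduct, PiLp.inner_apply, designMap_apply, Finset.mul_sum]
  rw [Finset.sum_comm]
  refine Finset.sum_congr rfl fun t _ => ?_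
  simp only [RCLike.inner_apply, conj_trivial, Finset.sum_mul, Finset.mul_sum]
  refine Finset.sum_congr rfl fun i _ => Finset.sum_congr rfl fun j _ => by ring

theorem quadForm_designMatrix (v : EuclideanSpace ℝ (Fin d)) :
    quadForm (designMatrix x) v = ‖designMap x v‖ ^ 2 := by
  rw [quadForm, dotProduct_designMatrix_mulVec, real_inner_self_eq_norm_sq]

/-- In an orthonormal eigenbasis `b` with eigenvalues `λⱼ`, `‖A v‖² = ∑ λⱼ ⟨bⱼ, v⟩²`. -/
theorem minEigenvalue_mul_norm_sq_le (v : EuclideanSpace ℝ (Fin d)) :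
    minEigenvalue x * ‖v‖ ^ 2 ≤ ‖designMap x v‖ ^ 2 := by
  set b := (designMatrix_isHermitian x).eigenvectorBasis
  have hb : ∀ j, ⟪designMap x v, designMap x (b j)⟫
      = (designMatrix_isHermitian x).eigenvalues j * ⟪b j, v⟫ := by
    intro j
    rw [← dotProduct_designMatrix_mulVec]
    have := (designMatrix_isHermitian x).mulVec_eigenvectorBasis j
    rw [show (fun i => b j i) = ⇑(b j) from rfl, this, dotProduct_smul, smul_eq_mul]
    simp [dotProduct, PiLp.inner_apply, b]
  have hsum : ‖designMap x v‖ ^ 2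
      = ∑ j, (designMatrix_isHermitian x).eigenvalues j * ⟪b j, v⟫ ^ 2 := by
    have e : designMap x v = ∑ j, ⟪b j, v⟫ • designMap x (b j) := by
      simp only [← map_smul, ← map_sum, b.sum_repr']
    rw [← real_inner_self_eq_norm_sq]
    nth_rewrite 2 [e]
    rw [inner_sum]
    refine Finset.sum_congr rfl fun j _ => ?_
    rw [inner_smul_right, hb]
    ring
  rw [hsum, ← b.sum_sq_inner_right v, Finset.mul_sum]
  refine Finset.sum_le_sum fun j _ => mul_le_mul_of_nonneg_right ?_ (sq_nonneg _)
  exact ciInf_le (Set.finite_range _).bddBelow j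

variable {x}

theorem norm_le_of_le_minEigenvalue (hx : 0 < minEigenvalue x) (v : EuclideanSpace ℝ (Fin d)) :
    √(minEigenvalue x) * ‖v‖ ≤ ‖designMap x v‖ := by
  refine (sq_le_sq₀ (by positivity) (norm_nonneg _)).1 ?_
  rw [mul_pow, Real.sq_sqrt hx.le]
  exact minEigenvalue_mul_norm_sq_le x v

theorem designMap_eq_zero (hx : 0 < minEigenvalue x) {v : EuclideanSpace ℝ (Fin d)}
    (hv : designMap x v = 0) : v = 0 := by
  have := norm_le_of_le_minEigenvalue hx v
  rw [hv, norm_zero] at this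
  exact norm_le_zero_iff.1 (le_of_mul_le_mul_left (by simpa using this) (Real.sqrt_pos.2 hx))

theorem isUnit_det_designMatrix (hx : 0 < minEigenvalue x) : IsUnit (designMatrix x).det := by
  rw [← Matrix.isUnit_iff_isUnit_det, ← Matrix.mulVec_injective_iff_isUnit]
  refine (injective_iff_map_eq_zero (designMatrix x).mulVecLin).2 fun v hv => ?_
  have h : quadForm (designMatrix x) (WithLp.toLp 2 v) = 0 := by
    have : (designMatrix x).mulVec v = 0 := hv
    simp [quadForm, this]
  rw [quadForm_designMatrix] at h
  have := designMap_eq_zero hx (by simpa using h)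
  simpa using this

/-- The vector `u = V⁻¹ v` represents `v` in the inner product given by `V`. -/
theorem exists_quadForm_inv_eq (hx : 0 < minEigenvalue x) (v : EuclideanSpace ℝ (Fin d)) :
    ∃ u, quadForm (designMatrix x)⁻¹ v = ‖designMap x u‖ ^ 2 ∧
      ∀ w, ⟪w, v⟫ = ⟪designMap x w, designMap x u⟫ := by
  set u : EuclideanSpace ℝ (Fin d) :=
    WithLp.toLp 2 ((designMatrix x)⁻¹.mulVec (fun i => v i)) with hu
  have huv : (designMatrix x).mulVec (fun i => u i) = fun i => v i := by
    simp [hu, Matrix.mul_nonsing_inv _ (isUnit_det_designMatrix hx)]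
  have hw : ∀ w, ⟪w, v⟫ = ⟪designMap x w, designMap x u⟫ := by
    intro w
    rw [← dotProduct_designMatrix_mulVec, huv]
    simp [dotProduct, PiLp.inner_apply, mul_comm]
  refine ⟨u, ?_, hw⟩
  rw [← real_inner_self_eq_norm_sq, ← hw]
  simp [quadForm, dotProduct, PiLp.inner_apply, hu]

/-- Solving `∑ₜ cₜ xₜ xₜᵀ w = v` for weights bounded below by `κ`. -/
theorem exists_weighted_representer (hx : 0 < minEigenvalue x) {c : Fin τ → ℝ} {κ : ℝ}
    (hκ : 0 < κ) (hc : ∀ t, κ ≤ c t) (v : EuclideanSpace ℝ (Fin d)) :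
    ∃ w, (∀ z, ⟪v, z⟫ = ∑ t, c t * ⟪x t, w⟫ * ⟪x t, z⟫) ∧
      κ * ‖designMap x w‖ ≤ √(quadForm (designMatrix x)⁻¹ v) := by
  let H : EuclideanSpace ℝ (Fin d) →ₗ[ℝ] EuclideanSpace ℝ (Fin d) :=
    ∑ t, c t • (innerₛₗ ℝ (x t)).smulRight (x t)
  have hH : ∀ w z, ⟪H w, z⟫ = ∑ t, c t * ⟪x t, w⟫ * ⟪x t, z⟫ := by
    intro w z
    simp only [H, LinearMap.sum_apply, LinearMap.smul_apply, LinearMap.smulRight_apply, sum_inner,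
      inner_smul_left, innerₛₗ_apply_apply, conj_trivial]
    exact Finset.sum_congr rfl fun t _ => by ring
  have hpos : ∀ w, κ * ‖designMap x w‖ ^ 2 ≤ ⟪H w, w⟫ := by
    intro w
    rw [hH, EuclideanSpace.real_norm_sq_eq, Finset.mul_sum]
    refine Finset.sum_le_sum fun t _ => ?_
    rw [designMap_apply, mul_assoc, ← sq]
    exact mul_le_mul_of_nonneg_right (hc t) (sq_nonneg _)
  have hinj : Function.Injective H := by
    refine (injective_iff_map_eq_zero H).2 fun w hw => designMap_eq_zero hx ?_
    have := hpos w
    rw [hw, inner_zero_left] at this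
    have h0 : ‖designMap x w‖ ^ 2 ≤ 0 := by
      by_contra! h
      exact absurd this (not_le.2 (mul_pos hκ h))
    simpa using le_antisymm h0 (sq_nonneg _)
  obtain ⟨w, hw⟩ := (LinearMap.injective_iff_surjective.1 hinj) v
  refine ⟨w, fun z => by rw [← hw, hH], ?_⟩
  obtain ⟨u, hu, hu'⟩ := exists_quadForm_inv_eq hx v
  rw [hu, Real.sqrt_sq (norm_nonneg _)]
  -- `κ ‖A w‖² ≤ ⟨H w, w⟩ = ⟨v, w⟩ = ⟨A u, A w⟩`, then Cauchy–Schwarz.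
  have h1 : κ * ‖designMap x w‖ ^ 2 ≤ ‖designMap x w‖ * ‖designMap x u‖ := by
    refine (hpos w).trans ?_
    rw [hw, real_inner_comm, hu']
    exact real_inner_le_norm _ _
  rcases (norm_nonneg (designMap x w)).eq_or_lt with h | h
  · rw [← h, mul_zero]; exact norm_nonneg _
  · exact le_of_mul_le_mul_left (by linarith) h

end Design

/-! ### Mean value expansions of the link -/

/-- The parameter `s` avoids cases on the sign of `h` and later identifies the intermediate point
with one on the segment from `θs` to `θ`. -/
theorem exists_sub_eq_deriv_mul {f : ℝ → ℝ} (hf : Differentiable ℝ f) (a h : ℝ) :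
    ∃ s ∈ Set.Ioo (0 : ℝ) 1, f (a + h) - f a = deriv f (a + s * h) * h := by
  have hg : ∀ s : ℝ, HasDerivAt (fun s => f (a + s * h)) (deriv f (a + s * h) * h) s := by
    intro s
    have h1 : HasDerivAt (fun s : ℝ => a + s * h) h s := by
      simpa using ((hasDerivAt_id s).mul_const h).const_add a
    exact ((hf (a + s * h)).hasDerivAt).comp s h1
  obtain ⟨s, hs, hs'⟩ := exists_hasDerivAt_eq_slope (fun s => f (a + s * h)) _ zero_lt_one
    (fun s _ => (hg s).continuousAt.continuousWithinAt) (fun s _ => hg s)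
  exact ⟨s, hs, by simpa using hs'.symm⟩

section Link

variable {ψ : ℝ → ℝ}

theorem differentiable_deriv_link (hψ : ContDiff ℝ 3 ψ) : Differentiable ℝ (deriv ψ) := by
  have := hψ.differentiable_iteratedDeriv 1 (by norm_num)
  rwa [iteratedDeriv_one] at this

theorem exists_deriv_sub_eq (hψ : ContDiff ℝ 3 ψ) (a h : ℝ) : ∃ s ∈ Set.Ioo (0 : ℝ) 1,
    deriv ψ (a + h) - deriv ψ a = iteratedDeriv 2 ψ (a + s * h) * h := by
  have := exists_sub_eq_deriv_mul (differentiable_deriv_link hψ) a h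
  rwa [iteratedDeriv_succ, iteratedDeriv_one]

theorem exists_iteratedDeriv_two_sub_eq (hψ : ContDiff ℝ 3 ψ) (a h : ℝ) : ∃ s ∈ Set.Ioo (0 : ℝ) 1,
    iteratedDeriv 2 ψ (a + h) - iteratedDeriv 2 ψ a = iteratedDeriv 3 ψ (a + s * h) * h := by
  have := exists_sub_eq_deriv_mul (hψ.differentiable_iteratedDeriv 2 (by norm_num)) a h
  rwa [← iteratedDeriv_succ] at this

/-- Two mean value steps replace Taylor's `1 / 2` by an unknown `s`; only its positivity matters for
concavity. -/
theorem exists_sub_tangent_eq (hψ : ContDiff ℝ 3 ψ) (a h : ℝ) : ∃ c, ∃ s ∈ Set.Ioo (0 : ℝ) 1,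
    ψ (a + h) - (ψ a + deriv ψ a * h) = iteratedDeriv 2 ψ c * (s * h ^ 2) := by
  obtain ⟨s, hs, h1⟩ := exists_sub_eq_deriv_mul (hψ.differentiable (by norm_num)) a h
  obtain ⟨s', -, h2⟩ := exists_deriv_sub_eq hψ a (s * h)
  exact ⟨_, s, hs, by linear_combination h1 + h * h2⟩

end Link

/-! ### Concavity, the score equation and localisation of the MLE -/

section Likelihood

variable {d τ : ℕ} {x : Fin τ → EuclideanSpace ℝ (Fin d)} {ψ : ℝ → ℝ} {y : Fin τ → ℝ}

theorem continuous_logLik (hψ : Continuous ψ) : Continuous (logLik ψ x y) := by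
  unfold logLik
  fun_prop

theorem logLik_sub_eq (hψ : ContDiff ℝ 3 ψ) (hψ'' : ∀ a, 0 < iteratedDeriv 2 ψ a)
    (θ₀ θ : EuclideanSpace ℝ (Fin d)) :
    ∃ q : Fin τ → ℝ, (∀ t, 0 < q t) ∧ logLik ψ x y θ - logLik ψ x y θ₀
      = ∑ t, (y t - deriv ψ ⟪x t, θ₀⟫) * ⟪x t, θ - θ₀⟫ - ∑ t, q t * ⟪x t, θ - θ₀⟫ ^ 2 := by
  choose c s hs h using fun t => exists_sub_tangent_eq hψ ⟪x t, θ₀⟫ ⟪x t, θ - θ₀⟫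
  refine ⟨fun t => iteratedDeriv 2 ψ (c t) * s t, fun t => mul_pos (hψ'' _) (hs t).1, ?_⟩
  rw [logLik, logLik, ← Finset.sum_sub_distrib, ← Finset.sum_sub_distrib]
  refine Finset.sum_congr rfl fun t _ => ?_
  have ht := h t
  rw [← inner_add_right, add_sub_cancel] at ht
  rw [inner_sub_right] at ht ⊢
  linear_combination -ht

/-- The log-likelihood lies below its tangent planes. -/
theorem logLik_sub_le (hψ : ContDiff ℝ 3 ψ) (hψ'' : ∀ a, 0 < iteratedDeriv 2 ψ a)
    (θ₀ θ : EuclideanSpace ℝ (Fin d)) :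
    logLik ψ x y θ - logLik ψ x y θ₀
      ≤ ∑ t, (y t - deriv ψ ⟪x t, θ₀⟫) * ⟪x t, θ - θ₀⟫ := by
  obtain ⟨q, hq, h⟩ := logLik_sub_eq (x := x) (y := y) hψ hψ'' θ₀ θ
  rw [h, sub_le_self_iff]
  exact Finset.sum_nonneg fun t _ => mul_nonneg (hq t).le (sq_nonneg _)

/-- The score equation. -/
theorem IsMLE.score_eq_zero (hψ : ContDiff ℝ 3 ψ) {θ : EuclideanSpace ℝ (Fin d)}
    (h : IsMLE ψ x y θ) (w : EuclideanSpace ℝ (Fin d)) :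
    ∑ t, (y t - deriv ψ ⟪x t, θ⟫) * ⟪x t, w⟫ = 0 := by
  have hd : HasDerivAt (fun s : ℝ => logLik ψ x y (θ + s • w))
      (∑ t, (y t - deriv ψ ⟪x t, θ⟫) * ⟪x t, w⟫) 0 := by
    simp only [logLik, inner_add_right, inner_smul_right]
    refine HasDerivAt.fun_sum fun t _ => ?_
    have h1 : HasDerivAt (fun s : ℝ => ⟪x t, θ⟫ + s * ⟪x t, w⟫) ⟪x t, w⟫ 0 := by
      simpa using ((hasDerivAt_id (0 : ℝ)).mul_const ⟪x t, w⟫).const_add ⟪x t, θ⟫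
    have h2 : HasDerivAt ψ (deriv ψ ⟪x t, θ⟫) (⟪x t, θ⟫ + 0 * ⟪x t, w⟫) := by
      rw [zero_mul, add_zero]
      exact (hψ.differentiable (by norm_num) _).hasDerivAt
    exact ((h1.const_mul (y t)).sub (h2.comp 0 h1)).congr_deriv (by ring)
  refine IsLocalMax.hasDerivAt_eq_zero (Filter.Eventually.of_forall fun s => ?_) hd
  simpa using h (θ + s • w)

/-- The score vanishes at `θ₀`, so the likelihood gap is minus a positively weighted sum of squares.
Maximality of `θ` kills every square, and `A` is injective. -/
theorem IsMLE.eq (hψ : ContDiff ℝ 3 ψ) (hψ'' : ∀ a, 0 < iteratedDeriv 2 ψ a)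
    (hx : 0 < minEigenvalue x) {θ θ₀ : EuclideanSpace ℝ (Fin d)}
    (h : IsMLE ψ x y θ) (h₀ : IsMLE ψ x y θ₀) : θ = θ₀ := by
  obtain ⟨q, hq, hL⟩ := logLik_sub_eq (x := x) (y := y) hψ hψ'' θ₀ θ
  rw [h₀.score_eq_zero hψ, zero_sub] at hL
  have hnn : ∀ t ∈ Finset.univ, 0 ≤ q t * ⟪x t, θ - θ₀⟫ ^ 2 :=
    fun t _ => mul_nonneg (hq t).le (sq_nonneg _)
  have h0 : ∑ t, q t * ⟪x t, θ - θ₀⟫ ^ 2 = 0 :=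
    le_antisymm (by linarith [h θ₀]) (Finset.sum_nonneg hnn)
  rw [Finset.sum_eq_zero_iff_of_nonneg hnn] at h0
  refine sub_eq_zero.1 (designMap_eq_zero hx ?_)
  ext t
  change ⟪x t, θ - θ₀⟫ = 0
  simpa only [mul_eq_zero, (hq t).ne', false_or, sq_eq_zero_iff] using h0 t (Finset.mem_univ t)

variable {θs : EuclideanSpace ℝ (Fin d)} {κ R : ℝ}

theorem norm_add_smul_sub_le_one {θ : EuclideanSpace ℝ (Fin d)} (hθ : ‖θ - θs‖ ≤ 1) {s : ℝ}
    (hs : s ∈ Set.Ioo (0 : ℝ) 1) : ‖θs + s • (θ - θs) - θs‖ ≤ 1 := by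
  rw [add_sub_cancel_left, norm_smul, Real.norm_of_nonneg hs.1.le]
  exact mul_le_one₀ hs.2.le (norm_nonneg _) hθ

theorem strong_monotonicity (hψ : ContDiff ℝ 3 ψ)
    (hκ : ∀ t θ, ‖θ - θs‖ ≤ 1 → κ ≤ iteratedDeriv 2 ψ ⟪x t, θ⟫)
    {θ : EuclideanSpace ℝ (Fin d)} (hθ : ‖θ - θs‖ ≤ 1) :
    κ * ‖designMap x (θ - θs)‖ ^ 2
      ≤ ∑ t, (deriv ψ ⟪x t, θ⟫ - deriv ψ ⟪x t, θs⟫) * ⟪x t, θ - θs⟫ := by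
  rw [EuclideanSpace.real_norm_sq_eq, Finset.mul_sum]
  refine Finset.sum_le_sum fun t _ => ?_
  obtain ⟨s, hs, h⟩ := exists_deriv_sub_eq hψ ⟪x t, θs⟫ ⟪x t, θ - θs⟫
  have hle := hκ t _ (norm_add_smul_sub_le_one hθ hs)
  rw [inner_add_right, inner_smul_right] at hle
  rw [← inner_add_right, add_sub_cancel] at h
  rw [h, designMap_apply, mul_assoc, ← sq]
  exact mul_le_mul_of_nonneg_right hle (sq_nonneg _)

theorem abs_deriv_remainder_le (hψ : ContDiff ℝ 3 ψ) {M : ℝ} {t : Fin τ}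
    (hM : ∀ θ, ‖θ - θs‖ ≤ 1 → |iteratedDeriv 3 ψ ⟪x t, θ⟫| ≤ M)
    {θ : EuclideanSpace ℝ (Fin d)} (hθ : ‖θ - θs‖ ≤ 1) :
    |deriv ψ ⟪x t, θ⟫ - deriv ψ ⟪x t, θs⟫ - iteratedDeriv 2 ψ ⟪x t, θs⟫ * ⟪x t, θ - θs⟫|
      ≤ M * ⟪x t, θ - θs⟫ ^ 2 := by
  obtain ⟨s, hs, h⟩ := exists_deriv_sub_eq hψ ⟪x t, θs⟫ ⟪x t, θ - θs⟫
  obtain ⟨s', hs', h'⟩ := exists_iteratedDeriv_two_sub_eq hψ ⟪x t, θs⟫ (s * ⟪x t, θ - θs⟫)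
  have hss : s' * s ∈ Set.Ioo (0 : ℝ) 1 :=
    ⟨mul_pos hs'.1 hs.1, mul_lt_one_of_nonneg_of_lt_one_left hs'.1.le hs'.2 hs.2.le⟩
  have hle := hM _ (norm_add_smul_sub_le_one hθ hss)
  rw [inner_add_right, inner_smul_right, mul_assoc] at hle
  rw [← inner_add_right, add_sub_cancel] at h
  rw [h, show ∀ a b c : ℝ, a * c - b * c = (a - b) * c by intros; ring, h']
  have e : ∀ a b c : ℝ, |a * (b * c) * c| = |a| * (|b| * c ^ 2) := by
    intro a b c
    rw [mul_assoc, mul_assoc, abs_mul, abs_mul, ← sq, abs_sq]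
  rw [e]
  refine mul_le_mul hle ?_ (by positivity) ((abs_nonneg _).trans hle)
  rw [abs_of_pos hs.1]
  exact mul_le_of_le_one_left (sq_nonneg _) hs.2.le

/-- On the event that the errors have correlation at most `R` with the unit vectors of the range of
the design, the MLE exists, is unique and is close to the true parameter. -/
theorem existsUnique_isMLE (hψ : ContDiff ℝ 3 ψ) (hψ'' : ∀ a, 0 < iteratedDeriv 2 ψ a)
    (hx : 0 < minEigenvalue x) (hκ0 : 0 < κ)
    (hκ : ∀ t θ, ‖θ - θs‖ ≤ 1 → κ ≤ iteratedDeriv 2 ψ ⟪x t, θ⟫)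
    (hR0 : 0 ≤ R) (hR : ∀ v, ∑ t, (y t - deriv ψ ⟪x t, θs⟫) * ⟪x t, v⟫ ≤ R * ‖designMap x v‖)
    {ς : ℝ} (hς0 : 0 < ς) (hς1 : ς ≤ 1) (hRς : R ≤ κ * (ς * √(minEigenvalue x))) :
    (∃! θ, IsMLE ψ x y θ) ∧ ∀ θ, IsMLE ψ x y θ →
      ‖θ - θs‖ ≤ ς ∧ κ * ‖designMap x (θ - θs)‖ ≤ R := by
  have score_split : ∀ θ v, ∑ t, (y t - deriv ψ ⟪x t, θ⟫) * ⟪x t, v⟫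
      = ∑ t, (y t - deriv ψ ⟪x t, θs⟫) * ⟪x t, v⟫
        - ∑ t, (deriv ψ ⟪x t, θ⟫ - deriv ψ ⟪x t, θs⟫) * ⟪x t, v⟫ := by
    intro θ v
    rw [← Finset.sum_sub_distrib]
    exact Finset.sum_congr rfl fun t _ => by ring
  -- Radial retraction onto the sphere of radius `ς` does not decrease the likelihood: the score
  -- there has no outward component, and the likelihood lies below its tangent plane.
  have outside : ∀ θ, ς < ‖θ - θs‖ →
      logLik ψ x y θ ≤ logLik ψ x y (θs + (ς / ‖θ - θs‖) • (θ - θs)) := by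
    intro θ hθ
    have hρ : 0 < ‖θ - θs‖ := hς0.trans hθ
    set s := ς / ‖θ - θs‖ with hs
    have hs0 : 0 < s := by positivity
    have hs1 : s < 1 := (div_lt_one hρ).2 hθ
    set θ₀ := θs + s • (θ - θs) with hθ₀
    have hsub : θ₀ - θs = s • (θ - θs) := by rw [hθ₀, add_sub_cancel_left]
    have hnorm : ‖θ₀ - θs‖ = ς := by
      rw [hsub, norm_smul, Real.norm_of_nonneg hs0.le, hs, div_mul_cancel₀ _ hρ.ne']
    have hθθ₀ : θ - θ₀ = ((1 - s) / s) • (θ₀ - θs) := by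
      rw [hsub, smul_smul, div_mul_cancel₀ _ hs0.ne', sub_smul, one_smul, hθ₀]
      abel
    have hscore : ∑ t, (y t - deriv ψ ⟪x t, θ₀⟫) * ⟪x t, θ₀ - θs⟫ ≤ 0 := by
      rw [score_split, sub_nonpos]
      -- With `v = θ₀ - θs`: `R ‖A v‖ ≤ κ ς √λ ‖A v‖ ≤ κ ‖A v‖²`.
      refine (hR _).trans (le_trans ?_ (strong_monotonicity hψ hκ (hnorm.trans_le hς1)))
      rw [sq, ← mul_assoc]
      refine mul_le_mul_of_nonneg_right (hRς.trans ?_) (norm_nonneg _)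
      refine mul_le_mul_of_nonneg_left ?_ hκ0.le
      rw [mul_comm, ← hnorm]
      exact norm_le_of_le_minEigenvalue hx _
    have := logLik_sub_le (x := x) (y := y) hψ hψ'' θ₀ θ
    simp only [hθθ₀, inner_smul_right, mul_left_comm _ ((1 - s) / s), ← Finset.mul_sum] at this
    have h2 : 0 ≤ (1 - s) / s := div_nonneg (by linarith) hs0.le
    have h3 := mul_nonpos_of_nonneg_of_nonpos h2 hscore
    linarith
  obtain ⟨θ', hθ'mem, hθ'⟩ := (isCompact_closedBall θs ς).exists_isMaxOn
    ⟨θs, Metric.mem_closedBall_self hς0.le⟩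
    (continuous_logLik (x := x) (y := y) hψ.continuous).continuousOn
  have hmle : IsMLE ψ x y θ' := by
    intro θ
    rcases le_or_gt ‖θ - θs‖ ς with h | h
    · exact hθ' (by simpa [dist_eq_norm] using h)
    · refine (outside θ h).trans (hθ' ?_)
      have hρ : 0 < ‖θ - θs‖ := hς0.trans h
      rw [mem_closedBall_iff_norm, add_sub_cancel_left, norm_smul,
        Real.norm_of_nonneg (by positivity), div_mul_cancel₀ _ hρ.ne']
  refine ⟨⟨θ', hmle, fun θ h => h.eq hψ hψ'' hx hmle⟩, fun θ h => ?_⟩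
  obtain rfl := h.eq hψ hψ'' hx hmle
  have hball : ‖θ - θs‖ ≤ ς := by simpa [dist_eq_norm] using hθ'mem
  refine ⟨hball, ?_⟩
  have h1 := strong_monotonicity hψ hκ (hball.trans hς1)
  have h2 := h.score_eq_zero hψ (θ - θs)
  rw [score_split, sub_eq_zero] at h2
  rw [← h2] at h1
  have h3 := h1.trans (hR _)
  rw [sq, ← mul_assoc] at h3
  rcases (norm_nonneg (designMap x (θ - θs))).eq_or_lt with h0 | h0
  · rwa [← h0, mul_zero]
  · exact le_of_mul_le_mul_right h3 h0

/-- Linearisation of the score equation at the true parameter. -/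
theorem IsMLE.abs_inner_le (hψ : ContDiff ℝ 3 ψ) {M u : ℝ}
    (hM : ∀ t θ, ‖θ - θs‖ ≤ 1 → |iteratedDeriv 3 ψ ⟪x t, θ⟫| ≤ M) (hM0 : 0 ≤ M)
    (hu : ∀ t, ‖x t‖ ≤ u) {v w : EuclideanSpace ℝ (Fin d)}
    (hw : ∀ z, ⟪v, z⟫ = ∑ t, iteratedDeriv 2 ψ ⟪x t, θs⟫ * ⟪x t, w⟫ * ⟪x t, z⟫)
    {θ : EuclideanSpace ℝ (Fin d)} (h : IsMLE ψ x y θ) (hθ : ‖θ - θs‖ ≤ 1) :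
    |⟪v, θ - θs⟫| ≤ |∑ t, (y t - deriv ψ ⟪x t, θs⟫) * ⟪x t, w⟫|
      + M * u * ‖w‖ * ‖designMap x (θ - θs)‖ ^ 2 := by
  set r : Fin τ → ℝ := fun t => deriv ψ ⟪x t, θ⟫ - deriv ψ ⟪x t, θs⟫
    - iteratedDeriv 2 ψ ⟪x t, θs⟫ * ⟪x t, θ - θs⟫ with hr
  -- Subtract the score equation at `θ` tested against `w`; by the choice of `w` the linear term is
  -- exactly `⟨v, θ - θs⟩`.
  have hsplit : ⟪v, θ - θs⟫
      = ∑ t, (y t - deriv ψ ⟪x t, θs⟫) * ⟪x t, w⟫ - ∑ t, r t * ⟪x t, w⟫ := by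
    rw [hw, ← sub_zero (∑ t, (y t - deriv ψ ⟪x t, θs⟫) * ⟪x t, w⟫), ← h.score_eq_zero hψ w,
      ← Finset.sum_sub_distrib, ← Finset.sum_sub_distrib]
    exact Finset.sum_congr rfl fun t _ => by rw [hr]; ring
  rw [hsplit]
  refine (abs_sub _ _).trans (add_le_add le_rfl ?_)
  refine (Finset.abs_sum_le_sum_abs _ _).trans ?_
  rw [EuclideanSpace.real_norm_sq_eq, Finset.mul_sum]
  refine Finset.sum_le_sum fun t _ => ?_
  rw [abs_mul, designMap_apply]
  have h1 := abs_deriv_remainder_le hψ (hM t) hθ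
  have h2 : |⟪x t, w⟫| ≤ u * ‖w‖ :=
    (abs_real_inner_le_norm _ _).trans (mul_le_mul_of_nonneg_right (hu t) (norm_nonneg _))
  calc |r t| * |⟪x t, w⟫| ≤ (M * ⟪x t, θ - θs⟫ ^ 2) * (u * ‖w‖) :=
        mul_le_mul h1 h2 (abs_nonneg _) (mul_nonneg hM0 (sq_nonneg _))
    _ = M * u * ‖w‖ * ⟪x t, θ - θs⟫ ^ 2 := by ring

end Likelihood

/-! ### The constants `κ` and `M` -/

section Constants

variable {d : ℕ} {𝒳 : Set (EuclideanSpace ℝ (Fin d))} {ψ : ℝ → ℝ} {θs : EuclideanSpace ℝ (Fin d)}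
  {u : ℝ}

theorem inner_mem_Icc (h𝒳 : ∀ x ∈ 𝒳, ‖x‖ ≤ u) {x θ : EuclideanSpace ℝ (Fin d)} (hx : x ∈ 𝒳)
    (hθ : ‖θ - θs‖ ≤ 1) : ⟪x, θ⟫ ∈ Set.Icc (-(u * (‖θs‖ + 1))) (u * (‖θs‖ + 1)) := by
  have hnorm : ‖θ‖ ≤ ‖θs‖ + 1 := by
    have := norm_add_le θs (θ - θs)
    rw [add_sub_cancel] at this
    linarith
  exact abs_le.1 ((abs_real_inner_le_norm x θ).trans
    (mul_le_mul (h𝒳 x hx) hnorm (norm_nonneg _) ((norm_nonneg x).trans (h𝒳 x hx))))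

/-- All arguments `xᵀθ` lie in one compact interval, where `ψ''` attains a positive minimum.
Nonemptiness matters because `sInf ∅ = 0`. -/
theorem kappa_pos (hψ : ContDiff ℝ 3 ψ) (hψ'' : ∀ a, 0 < iteratedDeriv 2 ψ a)
    (h𝒳n : 𝒳.Nonempty) (h𝒳 : ∀ x ∈ 𝒳, ‖x‖ ≤ u) : 0 < kappa ψ 𝒳 θs := by
  obtain ⟨x₀, hx₀⟩ := h𝒳n
  obtain ⟨c, -, hc⟩ := isCompact_Icc.exists_isMinOn
    ⟨_, inner_mem_Icc (θs := θs) (θ := θs) h𝒳 hx₀ (by simp)⟩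
    (hψ.continuous_iteratedDeriv 2 (by norm_num)).continuousOn
  refine lt_min ((hψ'' c).trans_le (le_csInf ⟨_, x₀, hx₀, θs, by simp, rfl⟩ ?_)) one_pos
  rintro _ ⟨x, hx, θ, hθ, rfl⟩
  exact hc (inner_mem_Icc h𝒳 hx hθ)

theorem kappa_le_one : kappa ψ 𝒳 θs ≤ 1 := min_le_right _ _

/-- The bound passes to the closure by continuity. The closure is used because `𝒳` need not be
measurable, whereas a statement under the law of the covariates needs a measurable set. -/
theorem kappa_le (hψ : ContDiff ℝ 3 ψ) (hψ'' : ∀ a, 0 < iteratedDeriv 2 ψ a)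
    {x θ : EuclideanSpace ℝ (Fin d)} (hx : x ∈ closure 𝒳) (hθ : ‖θ - θs‖ ≤ 1) :
    kappa ψ 𝒳 θs ≤ iteratedDeriv 2 ψ ⟪x, θ⟫ := by
  have hcont := hψ.continuous_iteratedDeriv 2 (by norm_num)
  refine closure_minimal (t := {x | kappa ψ 𝒳 θs ≤ iteratedDeriv 2 ψ ⟪x, θ⟫}) (fun z hz => ?_)
    (isClosed_le continuous_const (by fun_prop)) hx
  change kappa ψ 𝒳 θs ≤ iteratedDeriv 2 ψ ⟪z, θ⟫
  unfold kappa
  refine (min_le_left _ _).trans ?_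
  refine csInf_le ⟨0, ?_⟩ ⟨z, hz, θ, hθ, rfl⟩
  rintro _ ⟨x, -, θ, -, rfl⟩
  exact (hψ'' _).le

theorem one_le_thirdDerivBound : 1 ≤ thirdDerivBound ψ 𝒳 θs := le_max_right _ _

theorem le_thirdDerivBound (hψ : ContDiff ℝ 3 ψ) (h𝒳 : ∀ x ∈ 𝒳, ‖x‖ ≤ u)
    {x θ : EuclideanSpace ℝ (Fin d)} (hx : x ∈ closure 𝒳) (hθ : ‖θ - θs‖ ≤ 1) :
    |iteratedDeriv 3 ψ ⟪x, θ⟫| ≤ thirdDerivBound ψ 𝒳 θs := by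
  have hcont := hψ.continuous_iteratedDeriv 3 le_rfl
  refine closure_minimal (t := {x | |iteratedDeriv 3 ψ ⟪x, θ⟫| ≤ thirdDerivBound ψ 𝒳 θs})
    (fun z hz => ?_) (isClosed_le (by fun_prop) continuous_const) hx
  obtain ⟨C, hC⟩ := (isCompact_Icc (a := -(u * (‖θs‖ + 1)))
    (b := u * (‖θs‖ + 1))).bddAbove_image hcont.abs.continuousOn
  change |iteratedDeriv 3 ψ ⟪z, θ⟫| ≤ thirdDerivBound ψ 𝒳 θs
  unfold thirdDerivBound
  refine le_trans ?_ (le_max_left _ _)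
  refine le_csSup ⟨C, ?_⟩ ⟨z, hz, θ, hθ, rfl⟩
  rintro _ ⟨x, hx, θ, hθ, rfl⟩
  exact hC ⟨_, inner_mem_Icc h𝒳 hx hθ, rfl⟩

end Constants

/-! ### Probability bounds for a fixed design -/

/-- Only subadditivity of the outer measure enters, so the events about the MLE need not be shown
measurable. -/
theorem ofReal_one_sub_le_measure {Ω : Type*} [MeasurableSpace Ω] {P : Measure Ω}
    [IsProbabilityMeasure P] {s t : Set Ω} (hst : sᶜ ⊆ t) {p : ℝ} (hp : 0 ≤ p)
    (ht : P t ≤ ENNReal.ofReal p) : ENNReal.ofReal (1 - p) ≤ P s := by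
  rw [ENNReal.ofReal_sub _ hp, ENNReal.ofReal_one, tsub_le_iff_right]
  calc 1 = P Set.univ := measure_univ.symm
    _ ≤ P (s ∪ t) := measure_mono fun ω _ => by
        by_cases h : ω ∈ s
        · exact Or.inl h
        · exact Or.inr (hst h)
    _ ≤ P s + P t := measure_union_le _ _
    _ ≤ P s + ENNReal.ofReal p := by gcongr

section FixedDesign

variable {d τ : ℕ} {x : Fin τ → EuclideanSpace ℝ (Fin d)} {P : Measure (Fin τ → ℝ)}
  {ψ : ℝ → ℝ} {θs : EuclideanSpace ℝ (Fin d)} {σ : ℝ≥0} {δ κ : ℝ}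

/-- The event that the errors are correlated with some vector of the range of the design by more
than `σ √(3 (d + log (1 / δ)))` times its norm. -/
def largeNoise (x : Fin τ → EuclideanSpace ℝ (Fin d)) (ψ : ℝ → ℝ)
    (θs : EuclideanSpace ℝ (Fin d)) (σ : ℝ≥0) (δ : ℝ) : Set (Fin τ → ℝ) :=
  {y | ∃ u ∈ LinearMap.range (designMap x), σ * √(3 * (d + Real.log (1 / δ))) * ‖u‖
    < ∑ t, u t * (y t - deriv ψ ⟪x t, θs⟫)}

theorem iIndepFun_errors (hind : iIndepFun (fun (t : Fin τ) (y : Fin τ → ℝ) => y t) P) :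
    iIndepFun (fun (t : Fin τ) (y : Fin τ → ℝ) => y t - deriv ψ ⟪x t, θs⟫) P :=
  hind.comp (fun t z => z - deriv ψ ⟪x t, θs⟫) fun _ => measurable_id.sub_const _

theorem measure_largeNoise_le [IsProbabilityMeasure P] (hind : iIndepFun (fun (t : Fin τ) (y : Fin τ → ℝ) => y t) P)
    (hsub : ∀ t, HasSubgaussianMGF (fun y : Fin τ → ℝ => y t - deriv ψ ⟪x t, θs⟫) (σ ^ 2) P)
    (hσ : 0 < σ) (hδ0 : 0 < δ) : P (largeNoise x ψ θs σ δ) ≤ ENNReal.ofReal δ :=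
  measure_exists_mem_submodule_gt_le (iIndepFun_errors hind)
    (fun t => (measurable_pi_apply t).sub_const _) hsub hσ _
    (by simpa using LinearMap.finrank_range_le (designMap x)) hδ0

theorem sum_error_mul_le_of_notMem_largeNoise {y : Fin τ → ℝ} (hy : y ∉ largeNoise x ψ θs σ δ)
    (v : EuclideanSpace ℝ (Fin d)) :
    ∑ t, (y t - deriv ψ ⟪x t, θs⟫) * ⟪x t, v⟫
      ≤ σ * √(3 * (d + Real.log (1 / δ))) * ‖designMap x v‖ := by
  by_contra! h
  refine hy ⟨designMap x v, ⟨v, rfl⟩, h.trans_eq ?_⟩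
  exact Finset.sum_congr rfl fun t _ => mul_comm _ _

theorem existsUnique_isMLE_of_notMem_largeNoise (hd : 1 ≤ d) (hψ : ContDiff ℝ 3 ψ)
    (hψ'' : ∀ a, 0 < iteratedDeriv 2 ψ a) (hσ : 0 < σ) (hδ0 : 0 < δ) (hδ1 : δ < 1) (hκ0 : 0 < κ)
    (hκ : ∀ t θ, ‖θ - θs‖ ≤ 1 → κ ≤ iteratedDeriv 2 ψ ⟪x t, θ⟫)
    {ς : ℝ} (hς0 : 0 < ς) (hς1 : ς ≤ 1)
    (hx : 3 * (σ : ℝ) ^ 2 / (κ ^ 2 * ς ^ 2) * (d + Real.log (1 / δ)) ≤ minEigenvalue x)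
    {y : Fin τ → ℝ} (hy : y ∉ largeNoise x ψ θs σ δ) :
    0 < minEigenvalue x ∧ (∃! θ, IsMLE ψ x y θ) ∧ ∀ θ, IsMLE ψ x y θ →
      ‖θ - θs‖ ≤ ς ∧
        κ * ‖designMap x (θ - θs)‖ ≤ σ * √(3 * (d + Real.log (1 / δ))) := by
  have hσ' : (0 : ℝ) < σ := hσ
  have hd' : (1 : ℝ) ≤ d := by exact_mod_cast hd
  have hL : 0 < Real.log (1 / δ) := Real.log_pos ((one_lt_div hδ0).2 hδ1)
  have hx0 : 0 < minEigenvalue x := lt_of_lt_of_le (by positivity) hx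
  refine ⟨hx0, existsUnique_isMLE hψ hψ'' hx0 hκ0 hκ (by positivity)
    (sum_error_mul_le_of_notMem_largeNoise hy) hς0 hς1 ?_⟩
  -- Squared, `R ≤ κ ς √λ` is exactly the eigenvalue condition.
  refine (sq_le_sq₀ (by positivity) (by positivity)).1 ?_
  rw [mul_pow, mul_pow, mul_pow, Real.sq_sqrt hx0.le, Real.sq_sqrt (by positivity)]
  rw [div_mul_eq_mul_div, div_le_iff₀ (by positivity)] at hx
  linarith

theorem consistency_fixedDesign [IsProbabilityMeasure P] (hd : 1 ≤ d) (hψ : ContDiff ℝ 3 ψ)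
    (hψ'' : ∀ a, 0 < iteratedDeriv 2 ψ a) (hσ : 0 < σ)
    (hind : iIndepFun (fun (t : Fin τ) (y : Fin τ → ℝ) => y t) P)
    (hsub : ∀ t, HasSubgaussianMGF (fun y : Fin τ → ℝ => y t - deriv ψ ⟪x t, θs⟫) (σ ^ 2) P)
    (hδ0 : 0 < δ) (hδ1 : δ < 1) (hκ0 : 0 < κ)
    (hκ : ∀ t θ, ‖θ - θs‖ ≤ 1 → κ ≤ iteratedDeriv 2 ψ ⟪x t, θ⟫)
    {ς : ℝ} (hς0 : 0 < ς) (hς1 : ς ≤ 1)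
    (hx : 3 * (σ : ℝ) ^ 2 / (κ ^ 2 * ς ^ 2) * (d + Real.log (1 / δ)) ≤ minEigenvalue x) :
    ENNReal.ofReal (1 - δ) ≤ P
        {y | (∃! θ, IsMLE ψ x y θ) ∧ ∀ θ, IsMLE ψ x y θ →
          ‖θ - θs‖ ≤ ς ∧
          quadForm (designMatrix x) (θ - θs)
            ≤ 12 * (σ : ℝ) ^ 2 / κ ^ 2 * (d + Real.log (1 / δ)) ∧
          ‖θ - θs‖ ≤ √3 * σ / (κ * √(minEigenvalue x)) * √(d + Real.log (1 / δ))} := by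
  refine ofReal_one_sub_le_measure (t := largeNoise x ψ θs σ δ) ?_ hδ0.le
    (measure_largeNoise_le hind hsub hσ hδ0)
  rw [Set.compl_subset_comm]
  intro y hy
  obtain ⟨hx0, hex, hall⟩ :=
    existsUnique_isMLE_of_notMem_largeNoise hd hψ hψ'' hσ hδ0 hδ1 hκ0 hκ hς0 hς1 hx hy
  refine ⟨hex, fun θ hθ => ?_⟩
  obtain ⟨h1, h2⟩ := hall θ hθ
  have hL : 0 < Real.log (1 / δ) := Real.log_pos ((one_lt_div hδ0).2 hδ1)
  refine ⟨h1, ?_, ?_⟩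
  -- The argument gives the constant `3`; `12` leaves slack.
  · have h3 := pow_le_pow_left₀ (by positivity) h2 2
    rw [mul_pow, mul_pow, Real.sq_sqrt (by positivity)] at h3
    rw [quadForm_designMatrix, div_mul_eq_mul_div, le_div_iff₀ (by positivity)]
    have : 0 ≤ (σ : ℝ) ^ 2 * (d + Real.log (1 / δ)) := by positivity
    linarith
  · have h3 := mul_le_mul_of_nonneg_left (norm_le_of_le_minEigenvalue hx0 (θ - θs)) hκ0.le
    have hlam := Real.sqrt_pos.2 hx0
    rw [div_mul_eq_mul_div, le_div_iff₀ (by positivity)]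
    rw [Real.sqrt_mul (by norm_num)] at h2
    linarith

theorem directional_bound_fixedDesign [IsProbabilityMeasure P] (hd : 1 ≤ d) (hψ : ContDiff ℝ 3 ψ)
    (hψ'' : ∀ a, 0 < iteratedDeriv 2 ψ a) (hσ : 0 < σ)
    (hind : iIndepFun (fun (t : Fin τ) (y : Fin τ → ℝ) => y t) P)
    (hsub : ∀ t, HasSubgaussianMGF (fun y : Fin τ → ℝ => y t - deriv ψ ⟪x t, θs⟫) (σ ^ 2) P)
    (hδ0 : 0 < δ) (hδ1 : δ < 1) (hκ0 : 0 < κ) (hκ1 : κ ≤ 1)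
    (hκ : ∀ t θ, ‖θ - θs‖ ≤ 1 → κ ≤ iteratedDeriv 2 ψ ⟪x t, θ⟫)
    {M u : ℝ} (hM1 : 1 ≤ M)
    (hM : ∀ t θ, ‖θ - θs‖ ≤ 1 → |iteratedDeriv 3 ψ ⟪x t, θ⟫| ≤ M)
    (hu1 : 1 ≤ u) (hu : ∀ t, ‖x t‖ ≤ u)
    (hx : 512 * u ^ 2 * M ^ 2 * (σ : ℝ) ^ 2 / κ ^ 4 * ((d : ℝ) ^ 2 + Real.log (1 / δ))
      ≤ minEigenvalue x) (v : EuclideanSpace ℝ (Fin d)) :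
    ENNReal.ofReal (1 - 3 * δ) ≤ P
        {y | (∃! θ, IsMLE ψ x y θ) ∧ ∀ θ, IsMLE ψ x y θ →
          ‖θ - θs‖ ≤ 1 ∧
          |⟪v, θ - θs⟫| ≤ 3 * σ / κ * √(Real.log (1 / δ))
            * √(quadForm (designMatrix x)⁻¹ v)} := by
  -- If `3 δ ≥ 1` the claim is vacuous; otherwise `1 / δ > 3 > e` gives `ℓ ≥ 1`, needed in `hpoly`.
  rcases le_or_gt 1 (3 * δ) with hδ3 | hδ3
  · rw [ENNReal.ofReal_of_nonpos (by linarith)]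
    exact zero_le
  have hσ' : (0 : ℝ) < σ := hσ
  have hd' : (1 : ℝ) ≤ d := by exact_mod_cast hd
  have hL1 : 1 ≤ Real.log (1 / δ) := by
    rw [Real.le_log_iff_exp_le (by positivity)]
    have h3 : (3 : ℝ) ≤ 1 / δ := by rw [le_div_iff₀ hδ0]; exact hδ3.le
    linarith [Real.exp_one_lt_d9]
  set L := Real.log (1 / δ) with hLdef
  have hx' : 512 * u ^ 2 * M ^ 2 * (σ : ℝ) ^ 2 * ((d : ℝ) ^ 2 + L)
      ≤ minEigenvalue x * κ ^ 4 := by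
    rwa [div_mul_eq_mul_div, div_le_iff₀ (by positivity)] at hx
  have hx0 : 0 < minEigenvalue x := lt_of_lt_of_le (by positivity) hx
  -- The condition of part (A) with `ς = 1`.
  have hxA : 3 * (σ : ℝ) ^ 2 / (κ ^ 2 * 1 ^ 2) * (d + L) ≤ minEigenvalue x := by
    have h1 : (1 : ℝ) ≤ u ^ 2 * M ^ 2 := one_le_mul_of_one_le_of_one_le (one_le_pow₀ hu1)
      (one_le_pow₀ hM1)
    refine le_trans ?_ hx
    have h2 : κ ^ 4 ≤ κ ^ 2 * 1 ^ 2 := by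
      rw [one_pow, mul_one]; exact pow_le_pow_of_le_one hκ0.le hκ1 (by norm_num)
    have h3 : (d : ℝ) + L ≤ d ^ 2 + L := by nlinarith
    have h4 : 3 * (σ : ℝ) ^ 2 ≤ 512 * u ^ 2 * M ^ 2 * (σ : ℝ) ^ 2 := by
      have := mul_le_mul_of_nonneg_right h1 (sq_nonneg (σ : ℝ))
      nlinarith [sq_nonneg (σ : ℝ)]
    gcongr
  obtain ⟨w, hw, hwq⟩ := exists_weighted_representer hx0 hκ0
    (fun t => hκ t θs (by simp)) v
  set Q := √(quadForm (designMatrix x)⁻¹ v) with hQ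
  -- Failure budget: `δ` for the uniform noise bound, `2 δ` for the two-sided bound in the single
  -- direction `A w`.
  refine ofReal_one_sub_le_measure (t := largeNoise x ψ θs σ δ ∪
    {y | √2 * σ * √L * ‖designMap x w‖
      < |∑ t, designMap x w t * (y t - deriv ψ ⟪x t, θs⟫)|}) ?_ (by positivity) ?_
  · rw [Set.compl_subset_comm]
    intro y hy
    rw [Set.mem_compl_iff, Set.mem_union, not_or] at hy
    obtain ⟨hy1, hy2⟩ := hy
    simp only [Set.mem_ofPred_eq, not_lt] at hy2
    obtain ⟨-, hex, hall⟩ :=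
      existsUnique_isMLE_of_notMem_largeNoise hd hψ hψ'' hσ hδ0 hδ1 hκ0 hκ one_pos le_rfl hxA hy1
    refine ⟨hex, fun θ hθ => ?_⟩
    obtain ⟨h1, h2⟩ := hall θ hθ
    refine ⟨h1, ?_⟩
    refine (hθ.abs_inner_le hψ hM (by linarith) hu hw h1).trans ?_
    have hnoise : |∑ t, (y t - deriv ψ ⟪x t, θs⟫) * ⟪x t, w⟫| ≤ √2 * σ * √L * ‖designMap x w‖ := by
      simpa only [designMap_apply, mul_comm] using hy2
    have hlam := Real.sqrt_pos.2 hx0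
    have hwn := norm_le_of_le_minEigenvalue hx0 w
    have h3 := pow_le_pow_left₀ (by positivity) h2 2
    rw [mul_pow, mul_pow, Real.sq_sqrt (by positivity)] at h3
    -- What makes the remainder, at most `M u (‖A w‖ / √λ) R² / κ²`, no larger than `σ √ℓ ‖A w‖`.
    -- The two terms then total `√2 + 1 ≤ 3`.
    have hroot : 3 * (M * u * σ * (d + L)) ≤ κ ^ 2 * √(minEigenvalue x) * √L := by
      refine (sq_le_sq₀ (by positivity) (by positivity)).1 ?_
      have hpoly : 9 * (d + L) ^ 2 ≤ 512 * ((d : ℝ) ^ 2 + L) * L := by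
        nlinarith [sq_nonneg ((d : ℝ) - L), mul_nonneg (sq_nonneg (d : ℝ)) (sub_nonneg.2 hL1)]
      rw [mul_pow (_ * √(minEigenvalue x)), mul_pow _ √(minEigenvalue x), Real.sq_sqrt hx0.le,
        Real.sq_sqrt (by linarith)]
      calc (3 * (M * u * σ * (d + L))) ^ 2 = (M * u * σ) ^ 2 * (9 * (d + L) ^ 2) := by ring
        _ ≤ (M * u * σ) ^ 2 * (512 * ((d : ℝ) ^ 2 + L) * L) := by gcongr
        _ = (512 * u ^ 2 * M ^ 2 * (σ : ℝ) ^ 2 * ((d : ℝ) ^ 2 + L)) * L := by ring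
        _ ≤ (minEigenvalue x * κ ^ 4) * L := by gcongr
        _ = (κ ^ 2) ^ 2 * minEigenvalue x * L := by ring
    have hrem : M * u * ‖w‖ * ‖designMap x (θ - θs)‖ ^ 2 ≤ σ * √L * ‖designMap x w‖ := by
      refine le_of_mul_le_mul_left ?_ (show 0 < κ ^ 2 * √(minEigenvalue x) by positivity)
      calc κ ^ 2 * √(minEigenvalue x) * (M * u * ‖w‖ * ‖designMap x (θ - θs)‖ ^ 2)
          = M * u * (√(minEigenvalue x) * ‖w‖) * (κ ^ 2 * ‖designMap x (θ - θs)‖ ^ 2) := by ring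
        _ ≤ M * u * ‖designMap x w‖ * (σ ^ 2 * (3 * (d + L))) := by gcongr
        _ = 3 * (M * u * σ * (d + L)) * (σ * ‖designMap x w‖) := by ring
        _ ≤ κ ^ 2 * √(minEigenvalue x) * √L * (σ * ‖designMap x w‖) := by gcongr
        _ = κ ^ 2 * √(minEigenvalue x) * (σ * √L * ‖designMap x w‖) := by ring
    have h2' : √2 ≤ 2 := by rw [Real.sqrt_le_left (by norm_num)]; norm_num
    calc _ ≤ √2 * σ * √L * ‖designMap x w‖ + σ * √L * ‖designMap x w‖ := add_le_add hnoise hrem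
      _ ≤ 2 * σ * √L * ‖designMap x w‖ + σ * √L * ‖designMap x w‖ := by gcongr
      _ = 3 * σ / κ * √L * (κ * ‖designMap x w‖) := by field_simp; ring
      _ ≤ 3 * σ / κ * √L * Q := by gcongr
  · rw [show 3 * δ = δ + 2 * δ by ring, ENNReal.ofReal_add hδ0.le (by positivity)]
    exact (measure_union_le _ _).trans (add_le_add (measure_largeNoise_le hind hsub hσ hδ0)
      (measure_linearCombination_abs_gt_le (iIndepFun_errors hind) hsub hσ _ hδ0 hδ1))

end FixedDesign

/-- Almost every value of the covariates lies in the closure of `𝒳`. -/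
theorem CondIndepModel.ae_mem_closure {Ω : Type*} [MeasurableSpace Ω] {d τ : ℕ} {μ : Measure Ω}
    [IsProbabilityMeasure μ] {X : Ω → Fin τ → EuclideanSpace ℝ (Fin d)} {Y : Ω → Fin τ → ℝ}
    {𝒳 : Set (EuclideanSpace ℝ (Fin d))} {ψ : ℝ → ℝ} {θs : EuclideanSpace ℝ (Fin d)} {σ : ℝ≥0}
    (h : CondIndepModel μ X Y 𝒳 ψ θs σ) : ∀ᵐ x ∂(μ.map X), ∀ t, x t ∈ closure 𝒳 := by
  refine ae_all_iff.2 fun t => ?_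
  refine (ae_map_iff h.measurable_covariates.aemeasurable
    (measurable_pi_apply t isClosed_closure.measurableSet)).2 ?_
  filter_upwards [h.covariates_mem] with ω hω
  exact subset_closure (hω t)

end GLM

/-! ### Random covariates, by conditioning -/

theorem mainTheorem10 {Ω : Type*} [MeasurableSpace Ω] (μ : Measure Ω) [IsProbabilityMeasure μ]
    {d τ : ℕ} (hd : 1 ≤ d)
    (X : Ω → Fin τ → EuclideanSpace ℝ (Fin d)) (Y : Ω → Fin τ → ℝ)
    (𝒳 : Set (EuclideanSpace ℝ (Fin d))) (h𝒳 : 𝒳.Nonempty)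
    (ux : ℝ) (hux : 1 ≤ ux) (h𝒳ux : ∀ x ∈ 𝒳, ‖x‖ ≤ ux)
    (ψ : ℝ → ℝ) (hψ : ContDiff ℝ 3 ψ) (hψ'' : ∀ a, 0 < iteratedDeriv 2 ψ a)
    (θs : EuclideanSpace ℝ (Fin d)) (σ : ℝ≥0) (hσ : 0 < σ)
    (hmodel : GLM.CondIndepModel μ X Y 𝒳 ψ θs σ)
    (δ : ℝ) (hδ0 : 0 < δ) (hδ1 : δ < 1) :
    (∀ ς : ℝ, 0 < ς → ς ≤ 1 → ∀ᵐ x ∂(μ.map X),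
      3 * (σ : ℝ) ^ 2 / (GLM.kappa ψ 𝒳 θs ^ 2 * ς ^ 2) * (d + Real.log (1 / δ))
          ≤ GLM.minEigenvalue x →
      ENNReal.ofReal (1 - δ) ≤ condDistrib Y X μ x
        {y | (∃! θ, GLM.IsMLE ψ x y θ) ∧ ∀ θ, GLM.IsMLE ψ x y θ →
          ‖θ - θs‖ ≤ ς ∧
          GLM.quadForm (GLM.designMatrix x) (θ - θs)
            ≤ 12 * (σ : ℝ) ^ 2 / GLM.kappa ψ 𝒳 θs ^ 2 * (d + Real.log (1 / δ)) ∧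
          ‖θ - θs‖ ≤ √3 * σ / (GLM.kappa ψ 𝒳 θs * √(GLM.minEigenvalue x))
            * √(d + Real.log (1 / δ))}) ∧
    (∀ᵐ x ∂(μ.map X),
      512 * ux ^ 2 * GLM.thirdDerivBound ψ 𝒳 θs ^ 2 * (σ : ℝ) ^ 2 / GLM.kappa ψ 𝒳 θs ^ 4
          * ((d : ℝ) ^ 2 + Real.log (1 / δ)) ≤ GLM.minEigenvalue x →
      ∀ v : EuclideanSpace ℝ (Fin d),
      ENNReal.ofReal (1 - 3 * δ) ≤ condDistrib Y X μ x
        {y | (∃! θ, GLM.IsMLE ψ x y θ) ∧ ∀ θ, GLM.IsMLE ψ x y θ →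
          ‖θ - θs‖ ≤ 1 ∧
          |⟪v, θ - θs⟫| ≤ 3 * σ / GLM.kappa ψ 𝒳 θs * √(Real.log (1 / δ))
            * √(GLM.quadForm (GLM.designMatrix x)⁻¹ v)}) := by
  have hκ0 : 0 < GLM.kappa ψ 𝒳 θs := GLM.kappa_pos hψ hψ'' h𝒳 h𝒳ux
  refine ⟨fun ς hς0 hς1 => ?_, ?_⟩
  · filter_upwards [hmodel.ae_mem_closure, hmodel.condIndep, hmodel.subGaussian]
      with x hx hind hsub hle
    exact GLM.consistency_fixedDesign hd hψ hψ'' hσ hind hsub hδ0 hδ1 hκ0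
      (fun t θ hθ => GLM.kappa_le hψ hψ'' (hx t) hθ) hς0 hς1 hle
  · filter_upwards [hmodel.ae_mem_closure, hmodel.condIndep, hmodel.subGaussian]
      with x hx hind hsub hle v
    exact GLM.directional_bound_fixedDesign hd hψ hψ'' hσ hind hsub hδ0 hδ1 hκ0 GLM.kappa_le_one
      (fun t θ hθ => GLM.kappa_le hψ hψ'' (hx t) hθ) GLM.one_le_thirdDerivBound
      (fun t θ hθ => GLM.le_thirdDerivBound hψ h𝒳ux (hx t) hθ) hux
      (fun t => closure_minimal (t := {z | ‖z‖ ≤ ux}) h𝒳ux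
        (isClosed_le continuous_norm continuous_const) (hx t)) hle v
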